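/- Let $\mathcal C$ be an abelian category with enough projective objects which is hereditary, i.e. $\operatorname{Ext}^i_{\mathcal C}(X,Y)=0$ for all objects $X,Y$ and all $i\ge 2$. A differential $\mathcal C$-structure is a pair $(N,e)$ consisting of an object $N$ of $\mathcal C$ and an endomorphism $e$ of $N$ with $e^2=0$; a morphism $(N,e)\to(N',e')$ is a morphism $f:N\to N'$ in $\mathcal C$ with $e'f=fe$. Let $\operatorname{diff}(\mathcal C)$ be the category of differential $\mathcal C$-structures and let $\operatorname{diff}_{\rm perf}(\mathcal C)$ be its full subcategory of perfect differential $\mathcal C$-structures, i.e. of the pairs $(N,e)$ with $N$ projective in $\mathcal C$. The homotopy category of perfect differential $\mathcal C$-structures is the quotient of $\operatorname{diff}_{\rm perf}(\mathcal C)$ which identifies two morphisms $f,g:(N,e)\to(N',e')$ whenever $f-g=he+e'h$ for some morphism $h:N\to N'$ in $\mathcal C$. The stable category of perfect differential $\mathcal C$-structures is the quotient of $\operatorname{diff}_{\rm perf}(\mathcal C)$ which identifies two morphisms whenever their difference factors through an object of $\operatorname{diff}_{\rm perf}(\mathcal C)$ that is projective in $\operatorname{diff}(\mathcal C)$. Let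 $D^b(\mathcal C)$ be the bounded derived category of $\mathcal C$ with shift functor $[1]$. The orbit category $D^b(\mathcal C)/[1]$ has the same objects as $D^b(\mathcal C)$, its morphisms are $$\operatorname{Hom}_{D^b(\mathcal C)/[1]}(X,Y)=\bigoplus_{i\in\mathbb Z}\operatorname{Hom}_{D^b(\mathcal C)}(X,Y[i]),$$ and composition is the biadditive extension of $(g,f)\mapsto g[i]\circ f$ for $f:X\to Y[i]$ and $g:Y\to Z[j]$. Then the category $D^b(\mathcal C)/[1]$ is equivalent to the homotopy category of perfect differential $\mathcal C$-structures, and it is also equivalent to the stable category of perfect differential $\mathcal C$-structures. -/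

import Mathlib

open CategoryTheory CategoryTheory.Limits
open scoped DirectSum ZeroObject

universe w v u

/-- An abelian category is hereditary if its global dimension is at most one: the groups
`Ext^i(X, Y)` vanish for all objects `X`, `Y` and all `i ≥ 2`. -/
class IsHereditaryCategory (C : Type u) [Category.{v} C] [Abelian C] : Prop where
  hasProjectiveDimensionLE_one (X : C) : HasProjectiveDimensionLE X 1

/-! ### The orbit category modulo the shift -/

section Orbit

/-- The orbit category `D/[1]` of a category `D` with shift by `ℤ`: it has the same objects
as `D` (wrapped in a structure). -/
structure OrbitCategory (D : Type u) where
  /-- the underlying object -/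
  as : D

namespace OrbitCategory

variable {D : Type u} [Category.{v} D] [Preadditive D] [HasShift D ℤ]
  [∀ n : ℤ, (shiftFunctor D n).Additive]

/-- Composition of homogeneous morphisms `f : X ⟶ Y⟦i⟧` and `g : Y ⟶ Z⟦j⟧`, namely
`X ⟶ Y⟦i⟧ ⟶ Z⟦j⟧⟦i⟧ ≅ Z⟦j + i⟧`, as a biadditive map. -/
noncomputable def compHom (X Y Z : D) (i j : ℤ) :
    ShiftedHom X Y i →+ ShiftedHom Y Z j →+ ShiftedHom X Z (j + i) :=
  AddMonoidHom.mk' (fun f => AddMonoidHom.mk' (fun g => f.comp g rfl)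
    (fun g₁ g₂ => by simp)) (fun f₁ f₂ => by ext g; simp)

/-- Composition in the orbit category, the biadditive extension of `compHom` to
`⨁ i, Hom(X, Y⟦i⟧)`. -/
noncomputable def comp (X Y Z : D) :
    (⨁ i : ℤ, ShiftedHom X Y i) →+ (⨁ j : ℤ, ShiftedHom Y Z j) →+
      ⨁ k : ℤ, ShiftedHom X Z k :=
  DirectSum.toAddMonoid fun i =>
    AddMonoidHom.flip (DirectSum.toAddMonoid fun j => AddMonoidHom.flip
      ((AddMonoidHom.compHom (DirectSum.of (fun k : ℤ => ShiftedHom X Z k) (j + i))).comp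
        (compHom X Y Z i j)))

lemma comp_of {X Y Z : D} (i j k : ℤ) (h : j + i = k) (f : ShiftedHom X Y i)
    (g : ShiftedHom Y Z j) :
    comp X Y Z (DirectSum.of _ i f) (DirectSum.of _ j g) =
      DirectSum.of (fun k : ℤ => ShiftedHom X Z k) k (f.comp g h) := by
  subst h
  simp [comp, compHom]

/-- `Hom_{D/[1]}(X, Y) = ⨁ i, Hom_D(X, Y⟦i⟧)`. -/
noncomputable instance : Category (OrbitCategory D) where
  Hom X Y := ⨁ i : ℤ, ShiftedHom X.as Y.as i
  id X := DirectSum.of (fun i : ℤ => ShiftedHom X.as X.as i) 0 (ShiftedHom.mk₀ 0 rfl (𝟙 X.as))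
  comp {X Y Z} f g := comp X.as Y.as Z.as f g
  id_comp {X Y} f := by
    induction f using DirectSum.induction_on with
    | zero => simp
    | of i f => rw [comp_of 0 i i (by simp)]; simp
    | add f g hf hg => rw [map_add, hf, hg]
  comp_id {X Y} f := by
    induction f using DirectSum.induction_on with
    | zero => simp
    | of i f => rw [comp_of i 0 i (by simp)]; simp
    | add f g hf hg => rw [map_add, AddMonoidHom.add_apply, hf, hg]
  assoc {W X Y Z} f g h := by
    induction f using DirectSum.induction_on with
    | zero => simp
    | add f f' hf hf' => simp only [map_add, AddMonoidHom.add_apply, hf, hf']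
    | of i f =>
      induction g using DirectSum.induction_on with
      | zero => simp
      | add g g' hg hg' => simp only [map_add, AddMonoidHom.add_apply, hg, hg']
      | of j g =>
        induction h using DirectSum.induction_on with
        | zero => simp
        | add h h' hh hh' => simp only [map_add, hh, hh']
        | of k h =>
          rw [comp_of i j (j + i) rfl, comp_of j k (k + j) rfl,
            comp_of (j + i) k (k + j + i) (by ring), comp_of i (k + j) (k + j + i) rfl,
            ShiftedHom.comp_assoc f g h rfl rfl rfl]

end OrbitCategory

end Orbit

/-! ### Differential structures -/

/-- A differential `C`-structure: an object `N` of `C` with an endomorphism `e` such that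
`e ^ 2 = 0`. -/
structure DiffStructure (C : Type u) [Category.{v} C] [Preadditive C] where
  /-- the underlying object -/
  N : C
  /-- the differential -/
  e : N ⟶ N
  e_comp_e : e ≫ e = 0

namespace DiffStructure

variable {C : Type u} [Category.{v} C] [Preadditive C]

/-- Morphisms of differential structures are the morphisms commuting with the differentials. -/
@[ext]
structure Hom (X Y : DiffStructure C) where
  /-- the underlying morphism -/
  f : X.N ⟶ Y.N
  comm : f ≫ Y.e = X.e ≫ f

/-- The category `diff(C)`. -/
instance : Category (DiffStructure C) where
  Hom := Hom
  id X := ⟨𝟙 X.N, by simp⟩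
  comp φ ψ := ⟨φ.f ≫ ψ.f, by rw [Category.assoc, ψ.comm, ← Category.assoc, φ.comm,
    Category.assoc]⟩
  id_comp φ := Hom.ext (Category.id_comp _)
  comp_id φ := Hom.ext (Category.comp_id _)
  assoc φ ψ χ := Hom.ext (Category.assoc _ _ _)

@[ext]
lemma hom_ext {X Y : DiffStructure C} {φ ψ : X ⟶ Y} (h : φ.f = ψ.f) : φ = ψ := Hom.ext h

@[simp] lemma id_f (X : DiffStructure C) : Hom.f (𝟙 X) = 𝟙 X.N := rfl

@[simp] lemma comp_f {X Y Z : DiffStructure C} (φ : X ⟶ Y) (ψ : Y ⟶ Z) :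
    (φ ≫ ψ).f = φ.f ≫ ψ.f := rfl

variable (C) in
/-- A differential structure `(N, e)` is perfect if `N` is projective in `C`. -/
def isPerfect : ObjectProperty (DiffStructure C) := fun X => Projective X.N

end DiffStructure

/-- The category `diff_perf(C)` of perfect differential `C`-structures, a full subcategory
of `diff(C)`. -/
abbrev PerfDiff (C : Type u) [Category.{v} C] [Preadditive C] : Type (max u v) :=
  (DiffStructure.isPerfect C).FullSubcategory

namespace PerfDiff

variable (C : Type u) [Category.{v} C] [Preadditive C]

/-- Two morphisms `φ ψ : (N, e) ⟶ (N', e')` are homotopic if there is a morphism `h : N ⟶ N'`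
in `C` with `φ - ψ = h e + e' h` (the compositions below are in diagrammatic order). -/
def homotopic : HomRel (PerfDiff C) := fun X Y φ ψ =>
  ∃ h : X.obj.N ⟶ Y.obj.N, φ.hom.f - ψ.hom.f = X.obj.e ≫ h + h ≫ Y.obj.e

/-- The difference of two morphisms factors through a perfect differential structure which
is a projective object of the category `diff(C)`. -/
def stablyEqual : HomRel (PerfDiff C) := fun X Y φ ψ =>
  ∃ (P : PerfDiff C) (_ : Projective P.obj) (α : X ⟶ P) (β : P ⟶ Y),
    φ.hom.f - ψ.hom.f = (α ≫ β).hom.f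

instance : Congruence (homotopic C) where
  equivalence :=
    { refl := fun φ => ⟨0, by simp⟩
      symm := by
        rintro φ ψ ⟨h, hh⟩
        refine ⟨-h, ?_⟩
        rw [← neg_sub, hh]
        simp [add_comm]
      trans := by
        rintro φ ψ χ ⟨h, hh⟩ ⟨k, hk⟩
        refine ⟨h + k, ?_⟩
        rw [← sub_add_sub_cancel _ ψ.hom.f, hh, hk]
        simp only [Preadditive.comp_add, Preadditive.add_comp]
        abel }
  comp_left := by
    rintro X Y Z φ ψ χ ⟨h, hh⟩
    refine ⟨φ.hom.f ≫ h, ?_⟩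
    have := φ.hom.comm
    simp only [ObjectProperty.FullSubcategory.comp_hom, DiffStructure.comp_f,
      ← Preadditive.comp_sub, hh, Preadditive.comp_add]
    simp only [← Category.assoc, this]
  comp_right := by
    rintro X Y Z φ ψ χ ⟨h, hh⟩
    refine ⟨h ≫ χ.hom.f, ?_⟩
    have := χ.hom.comm
    simp only [ObjectProperty.FullSubcategory.comp_hom, DiffStructure.comp_f,
      ← Preadditive.sub_comp, hh, Preadditive.add_comp, Category.assoc, this]

section

variable {C} [HasBinaryBiproducts C]

/-- The direct sum of two perfect differential structures. -/
noncomputable def sum (P Q : PerfDiff C) : PerfDiff C where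
  obj :=
    { N := P.obj.N ⊞ Q.obj.N
      e := biprod.map P.obj.e Q.obj.e
      e_comp_e := by ext <;> simp [P.obj.e_comp_e, Q.obj.e_comp_e] }
  property := by
    have : Projective P.obj.N := P.property
    have : Projective Q.obj.N := Q.property
    exact inferInstanceAs (Projective (P.obj.N ⊞ Q.obj.N))

lemma projective_sum (P Q : PerfDiff C) [Projective P.obj] [Projective Q.obj] :
    Projective (sum P Q).obj where
  factors {E X} f p _ := by
    let iP : P.obj ⟶ (sum P Q).obj := ⟨biprod.inl, by simp [sum]⟩
    let iQ : Q.obj ⟶ (sum P Q).obj := ⟨biprod.inr, by simp [sum]⟩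
    let a : P.obj ⟶ E := Projective.factorThru (iP ≫ f) p
    let b : Q.obj ⟶ E := Projective.factorThru (iQ ≫ f) p
    have ha : a.f ≫ p.f = biprod.inl ≫ f.f :=
      congrArg DiffStructure.Hom.f (Projective.factorThru_comp (iP ≫ f) p)
    have hb : b.f ≫ p.f = biprod.inr ≫ f.f :=
      congrArg DiffStructure.Hom.f (Projective.factorThru_comp (iQ ≫ f) p)
    refine ⟨⟨biprod.desc a.f b.f, ?_⟩, ?_⟩
    · refine biprod.hom_ext' _ _ ?_ ?_
      · simp [sum, a.comm]
      · simp [sum, b.comm]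
    · refine DiffStructure.hom_ext (biprod.hom_ext' _ _ ?_ ?_)
      · exact (biprod.inl_desc_assoc _ _ _).trans ha
      · exact (biprod.inr_desc_assoc _ _ _).trans hb

end

end PerfDiff

section

variable (C : Type u) [Category.{v} C] [Abelian C]

instance : Congruence (PerfDiff.stablyEqual C) where
  equivalence {X Y} :=
    { refl := fun φ => by
        let Z : PerfDiff C := ⟨⟨0, 0, by simp⟩, (inferInstance : Projective (0 : C))⟩
        have hZ : IsZero Z.obj.N := isZero_zero C
        refine ⟨Z, ⟨fun f p _ => ⟨⟨0, by simp⟩, ?_⟩⟩, ⟨⟨0, by simp⟩⟩, ⟨⟨0, by simp⟩⟩, by simp⟩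
        exact DiffStructure.hom_ext (hZ.eq_of_src _ _)
      symm := by
        rintro φ ψ ⟨P, hP, α, β, h⟩
        refine ⟨P, hP, ⟨⟨-α.hom.f, by simp [α.hom.comm]⟩⟩, β, ?_⟩
        rw [← neg_sub, h]
        simp
      trans := by
        rintro φ ψ χ ⟨P, hP, α, β, h⟩ ⟨Q, hQ, γ, δ, k⟩
        refine ⟨PerfDiff.sum P Q, PerfDiff.projective_sum P Q,
          ⟨⟨biprod.lift α.hom.f γ.hom.f, ?_⟩⟩, ⟨⟨biprod.desc β.hom.f δ.hom.f, ?_⟩⟩, ?_⟩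
        · refine biprod.hom_ext _ _ ?_ ?_
          · simp [PerfDiff.sum, α.hom.comm]
          · simp [PerfDiff.sum, γ.hom.comm]
        · refine biprod.hom_ext' _ _ ?_ ?_
          · simp [PerfDiff.sum, β.hom.comm]
          · simp [PerfDiff.sum, δ.hom.comm]
        · rw [← sub_add_sub_cancel _ ψ.hom.f, h, k]
          exact (biprod.lift_desc ..).symm }
  comp_left := by
    rintro X Y Z φ ψ χ ⟨P, hP, α, β, h⟩
    refine ⟨P, hP, φ ≫ α, β, ?_⟩
    simpa [← Preadditive.comp_sub] using congrArg (φ.hom.f ≫ ·) h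
  comp_right := by
    rintro X Y Z φ ψ χ ⟨P, hP, α, β, h⟩
    refine ⟨P, hP, α, β ≫ χ, ?_⟩
    simpa [← Preadditive.sub_comp] using congrArg (· ≫ χ.hom.f) h

/-- The homotopy category of perfect differential `C`-structures. -/
abbrev HomotopyPerfDiff : Type (max u v) := CategoryTheory.Quotient (PerfDiff.homotopic C)

/-- The stable category of perfect differential `C`-structures: the quotient of `diff_perf(C)`
by the ideal of morphisms factoring through projectives. -/
abbrev StablePerfDiff : Type (max u v) := CategoryTheory.Quotient (PerfDiff.stablyEqual C)

end

/-! Both categories are quotients of one category `TwoTermComplex` by the same congruence. Its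
objects are monomorphisms `K⁰ ⟶ K¹` between projectives, that is, length-one projective resolutions
of `K¹/K⁰`. Its morphisms are pairs `(φ, β)` of chain maps of degrees 0 and 1; no other degree
occurs, already at chain level (`shiftedHom_eq_zero`).

On the differential side, `K` goes to `K⁰ ⊞ K¹` with `e` induced by `d`. A morphism is a triangular
matrix with diagonal `φ` and corner `β`, the other corner vanishing because `d` is monic, so `tot`
is full. It is essentially surjective because subobjects of projectives are projective, whence `N ≅
im e ⊞ ker e` with `im e ⊆ ker e`. Two morphisms are homotopic iff their `φ` and their `β` are
(`homotopic_tot_map_iff`).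

On the derived side, `K` is K-projective, so `toDerivedOrbit` is full and identifies morphisms under
the same condition (`toDerivedOrbit_map_eq_iff`). A bounded complex splits into shifts of its
cohomology, and shifts become isomorphic in the orbit category; hence every object there comes from
an object of `C`, and so from a resolution (`essImage_mapOrbit_boundedι`).

The stable category is the homotopy category because a map is null-homotopic iff it factors through
a projective (`stablyEqual_eq_homotopic`). -/

namespace OrbitCategory

/-! ### Functoriality of the orbit category -/

section

variable {D : Type*} [Category* D] [Preadditive D] [HasShift D ℤ]
  [∀ n : ℤ, (shiftFunctor D n).Additive]

noncomputable instance (X Y : OrbitCategory D) : AddCommGroup (X ⟶ Y) :=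
  (inferInstance : AddCommGroup (⨁ i : ℤ, ShiftedHom X.as Y.as i))

noncomputable instance : Preadditive (OrbitCategory D) where
  homGroup _ _ := inferInstance
  add_comp X Y Z f f' g := DFunLike.congr_fun (map_add (comp X.as Y.as Z.as) f f') g
  comp_add X Y Z f g g' := map_add (comp X.as Y.as Z.as f) g g'

/-- The homogeneous morphism of degree `i` in the orbit category. -/
noncomputable def homMk {X Y : D} (i : ℤ) :
    ShiftedHom X Y i →+ ((⟨X⟩ : OrbitCategory D) ⟶ ⟨Y⟩) :=
  DirectSum.of (fun i : ℤ => ShiftedHom X Y i) i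

lemma homMk_comp {X Y Z : D} {i j : ℤ} (k : ℤ) (h : j + i = k) (f : ShiftedHom X Y i)
    (g : ShiftedHom Y Z j) : homMk i f ≫ homMk j g = homMk k (f.comp g h) :=
  comp_of i j k h f g

lemma id_eq_homMk (X : D) : 𝟙 (⟨X⟩ : OrbitCategory D) = homMk 0 (ShiftedHom.mk₀ 0 rfl (𝟙 X)) := rfl

@[elab_as_elim]
lemma hom_induction {X Y : D} {motive : ((⟨X⟩ : OrbitCategory D) ⟶ ⟨Y⟩) → Prop}
    (f : (⟨X⟩ : OrbitCategory D) ⟶ ⟨Y⟩) (zero : motive 0)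
    (homMk : ∀ (i : ℤ) (f : ShiftedHom X Y i), motive (homMk i f))
    (add : ∀ f g, motive f → motive g → motive (f + g)) : motive f :=
  DirectSum.induction_on f zero homMk add

variable (D) in
/-- The projection functor from a category with shift to its orbit category. -/
@[simps obj]
noncomputable def proj : D ⥤ OrbitCategory D where
  obj X := ⟨X⟩
  map f := homMk 0 (ShiftedHom.mk₀ 0 rfl f)
  map_id X := rfl
  map_comp f g := by
    rw [homMk_comp 0 (zero_add 0), ShiftedHom.mk₀_comp_mk₀]

instance : (proj D).Additive where
  map_add {X Y f g} := by
    change homMk 0 (ShiftedHom.mk₀ 0 rfl (f + g)) = _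
    rw [ShiftedHom.mk₀_add]
    exact map_add (homMk 0) _ _

/-- An object becomes isomorphic to its shifts in the orbit category. -/
noncomputable def shiftIso (X : D) (n : ℤ) : (⟨X⟦n⟧⟩ : OrbitCategory D) ≅ ⟨X⟩ where
  hom := homMk n (𝟙 (X⟦n⟧))
  inv := homMk (-n) ((shiftFunctorCompIsoId D n (-n) (add_neg_cancel n)).inv.app X)
  hom_inv_id := by
    refine (homMk_comp 0 (by simp) _ _).trans ?_
    rw [id_eq_homMk]
    congr 1
    simp only [ShiftedHom.comp, shift_shiftFunctorCompIsoId_add_neg_cancel_inv_app]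
    simp [shiftFunctorCompIsoId, ShiftedHom.mk₀, shiftFunctorZero']
  inv_hom_id := by
    refine (homMk_comp 0 (by simp) _ _).trans ?_
    rw [id_eq_homMk]
    congr 1
    simp [shiftFunctorCompIsoId, ShiftedHom.comp, ShiftedHom.mk₀, shiftFunctorZero']

end

section

variable {D D' : Type*} [Category* D] [Preadditive D] [HasShift D ℤ]
  [∀ n : ℤ, (shiftFunctor D n).Additive]
  [Category* D'] [Preadditive D'] [HasShift D' ℤ]
  [∀ n : ℤ, (shiftFunctor D' n).Additive]
  (F : D ⥤ D') [F.Additive] [F.CommShift ℤ]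

/-- The action of a functor on shifted morphisms as an additive map. -/
def shiftedHomMap (X Y : D) (i : ℤ) :
    ShiftedHom X Y i →+ ShiftedHom (F.obj X) (F.obj Y) i :=
  AddMonoidHom.mk' (fun f => f.map F) (fun _ _ => ShiftedHom.map_add _ _ _)

/-- The action on morphisms of the functor between orbit categories. -/
noncomputable def mapHom (X Y : D) : ((⟨X⟩ : OrbitCategory D) ⟶ ⟨Y⟩) →+
    ((⟨F.obj X⟩ : OrbitCategory D') ⟶ ⟨F.obj Y⟩) :=
  DirectSum.map (fun i => shiftedHomMap F X Y i)

lemma mapHom_homMk {X Y : D} {i : ℤ} (f : ShiftedHom X Y i) :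
    mapHom F X Y (homMk i f) = homMk i (f.map F) :=
  DirectSum.map_of _ _ _

/-- The functor between orbit categories induced by an additive functor commuting
with shifts. -/
@[simps obj]
noncomputable def mapOrbit : OrbitCategory D ⥤ OrbitCategory D' where
  obj X := ⟨F.obj X.as⟩
  map {X Y} f := mapHom F X.as Y.as f
  map_id X := by
    change mapHom F _ _ (homMk 0 _) = _
    rw [mapHom_homMk, ShiftedHom.map_mk₀, F.map_id, id_eq_homMk]
  map_comp {X Y Z} f g := by
    induction f using hom_induction with
    | zero => simp
    | add f f' hf hf' => simp only [Preadditive.add_comp, map_add, hf, hf']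
    | homMk i f =>
      induction g using hom_induction with
      | zero => simp
      | add g g' hg hg' => simp only [Preadditive.comp_add, map_add, hg, hg']
      | homMk j g =>
        rw [homMk_comp _ rfl]
        erw [mapHom_homMk, mapHom_homMk, mapHom_homMk]
        rw [ShiftedHom.map_comp, homMk_comp]

lemma mapOrbit_map_homMk {X Y : D} {i : ℤ} (f : ShiftedHom X Y i) :
    (mapOrbit F).map (homMk i f) = homMk i (f.map F) :=
  mapHom_homMk F f

instance : (mapOrbit F).Additive where
  map_add {X Y f g} := map_add (mapHom F X.as Y.as) f g

instance [F.Faithful] : (mapOrbit F).Faithful where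
  map_injective {X Y} := by
    refine (DirectSum.map_injective _).2 fun i f g h => ?_
    exact F.map_injective ((cancel_mono ((F.commShiftIso i).hom.app Y.as)).1 h)

instance [F.Full] : (mapOrbit F).Full where
  map_surjective {X Y} := by
    refine (DirectSum.map_surjective _).2 fun i f => ?_
    obtain ⟨g, hg⟩ := F.map_surjective (f ≫ (F.commShiftIso i).inv.app Y.as)
    refine ⟨g, ?_⟩
    change F.map g ≫ (F.commShiftIso i).hom.app Y.as = f
    simp [hg]

end

end OrbitCategory

/-! ### Comparing two quotients of one category -/

namespace CategoryTheory

variable {T A B E : Type*} [Category* T] [Category* A] [Category* B] [Category* E]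

/-- Two full and essentially surjective functors from the same category which identify
the same morphisms have equivalent targets. -/
lemma nonempty_equivalence_of_full_of_essSurj (G : T ⥤ A) (H : T ⥤ B) [G.Full] [G.EssSurj]
    [H.Full] [H.EssSurj]
    (h : ∀ ⦃X Y : T⦄ (f g : X ⟶ Y), G.map f = G.map g ↔ H.map f = H.map g) :
    Nonempty (A ≌ B) := by
  -- Both targets are equivalent to the quotient of `T` by this common relation.
  let r : HomRel T := fun X Y f g => G.map f = G.map g
  let G' : Quotient r ⥤ A := Quotient.lift r G (fun _ _ _ _ h => h)
  let H' : Quotient r ⥤ B := Quotient.lift r H (fun _ _ _ _ h' => (h _ _).1 h')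
  have hG : Quotient.functor r ⋙ G' = G := Quotient.lift_spec _ _ _
  have hH : Quotient.functor r ⋙ H' = H := Quotient.lift_spec _ _ _
  have : G'.EssSurj := by
    have : (Quotient.functor r ⋙ G').EssSurj := by rw [hG]; infer_instance
    exact ⟨fun Y => ⟨_, ⟨(Quotient.functor r ⋙ G').objObjPreimageIso Y⟩⟩⟩
  have : H'.EssSurj := by
    have : (Quotient.functor r ⋙ H').EssSurj := by rw [hH]; infer_instance
    exact ⟨fun Y => ⟨_, ⟨(Quotient.functor r ⋙ H').objObjPreimageIso Y⟩⟩⟩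
  have : G'.Full := ⟨fun {X Y} f => by
    obtain ⟨g, hg⟩ := G.map_surjective f
    exact ⟨(Quotient.functor r).map g, hg⟩⟩
  have : H'.Full := ⟨fun {X Y} f => by
    obtain ⟨g, hg⟩ := H.map_surjective f
    exact ⟨(Quotient.functor r).map g, hg⟩⟩
  have : G'.Faithful := ⟨fun {X Y} f g h' => by
    obtain ⟨f, rfl⟩ := (Quotient.functor r).map_surjective f
    obtain ⟨g, rfl⟩ := (Quotient.functor r).map_surjective g
    exact Quotient.sound r h'⟩
  have : H'.Faithful := ⟨fun {X Y} f g h' => by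
    obtain ⟨f, rfl⟩ := (Quotient.functor r).map_surjective f
    obtain ⟨g, rfl⟩ := (Quotient.functor r).map_surjective g
    exact Quotient.sound r ((h f g).2 h')⟩
  have : G'.IsEquivalence := {}
  have : H'.IsEquivalence := {}
  exact ⟨G'.asEquivalence.symm.trans H'.asEquivalence⟩

/-- A variant of `nonempty_equivalence_of_full_of_essSurj` where the first functor takes values
in a category containing `A` as a full subcategory. -/
lemma nonempty_equivalence_of_essImage_eq (F : A ⥤ E) (G : T ⥤ E) (H : T ⥤ B) [F.Full]
    [F.Faithful] [G.Full] [H.Full] [H.EssSurj] (hFG : F.essImage = G.essImage)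
    (h : ∀ ⦃X Y : T⦄ (f g : X ⟶ Y), G.map f = G.map g ↔ H.map f = H.map g) :
    Nonempty (A ≌ B) := by
  obtain ⟨e⟩ := nonempty_equivalence_of_full_of_essSurj G.toEssImage H (fun X Y f g => by
    rw [← h, ← G.essImage.ι.map_injective.eq_iff]; rfl)
  exact ⟨F.toEssImage.asEquivalence.trans
    ((ObjectProperty.fullSubcategoryCongr hFG).trans e)⟩

end CategoryTheory

/-! ### Free differential structures; stable versus homotopy relation -/

namespace DiffStructure

section

variable {C : Type u} [Category.{v} C] [Preadditive C] [HasBinaryBiproducts C]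

/-- The free differential structure on an object. -/
noncomputable abbrev free (M : C) : DiffStructure C where
  N := M ⊞ M
  e := biprod.fst ≫ biprod.inr
  e_comp_e := by simp

/-- The morphism from a free differential structure extending a morphism in `C`. -/
noncomputable abbrev freeDesc {M : C} {Y : DiffStructure C} (g : M ⟶ Y.N) : free M ⟶ Y where
  f := biprod.desc g (g ≫ Y.e)
  comm := by
    refine biprod.hom_ext' _ _ ?_ ?_ <;> simp [Y.e_comp_e]

/-- The morphism to a free differential structure attached to a morphism in `C`. -/
noncomputable abbrev freeLift {M : C} {Y : DiffStructure C} (g : Y.N ⟶ M) : Y ⟶ free M where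
  f := biprod.lift (Y.e ≫ g) g
  comm := by
    refine biprod.hom_ext _ _ ?_ ?_ <;> simp [reassoc_of% Y.e_comp_e]

lemma freeDesc_comp {M : C} {X Y : DiffStructure C} (g : M ⟶ X.N) (p : X ⟶ Y) :
    freeDesc g ≫ p = freeDesc (g ≫ p.f) := by
  ext1
  refine biprod.hom_ext' _ _ ?_ ?_ <;> simp [p.comm]

lemma eq_freeDesc {M : C} {Y : DiffStructure C} (p : free M ⟶ Y) :
    p = freeDesc (biprod.inl ≫ p.f) := by
  ext1
  refine biprod.hom_ext' _ _ (by simp) ?_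
  have := biprod.inl ≫= p.comm
  simpa using this.symm

/-- The forgetful functor to `C` preserves epimorphisms. -/
lemma epi_f {X Y : DiffStructure C} (p : X ⟶ Y) [Epi p] : Epi p.f where
  left_cancellation {Z} g h w := by
    -- `free` is also right adjoint to the forgetful functor, so equality can be tested after
    -- transposing to maps out of `Y`, where `p` can be cancelled.
    have : freeLift g = freeLift h := by
      rw [← cancel_epi p]
      ext1
      refine biprod.hom_ext _ _ ?_ ?_
      · simp [reassoc_of% p.comm, w]
      · simpa using w
    simpa using congr(Hom.f $this ≫ biprod.snd)

/-- `free` is left adjoint to a functor preserving epimorphisms. -/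
instance (M : C) [Projective M] : Projective (free M) where
  factors {E X} f p _ := by
    have := epi_f p
    refine ⟨freeDesc (Projective.factorThru (biprod.inl ≫ f.f) p.f), ?_⟩
    rw [freeDesc_comp, Projective.factorThru_comp, ← eq_freeDesc]

instance (Y : DiffStructure C) : Epi (freeDesc (𝟙 Y.N)) where
  left_cancellation g h w := by
    ext1
    simpa using congr(biprod.inl ≫ Hom.f $w)

end

end DiffStructure

namespace PerfDiff

variable {C : Type u} [Category.{v} C] [Abelian C]

open DiffStructure

/-- A projective structure is a retract of a free one, hence contractible; conversely a homotopy `h`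
is exactly a factorization through the free structure on the target. -/
lemma stablyEqual_eq_homotopic : stablyEqual C = homotopic C := by
  refine funext fun X => funext fun Y => funext fun φ => funext fun ψ => propext ?_
  constructor
  · rintro ⟨P, _, α, β, h⟩
    obtain ⟨s, hs⟩ : ∃ s, s ≫ freeDesc (𝟙 P.obj.N) = 𝟙 P.obj := ⟨_, Projective.factorThru_comp _ _⟩
    replace hs : s.f ≫ biprod.desc (𝟙 _) P.obj.e = 𝟙 P.obj.N := by
      simpa using congr(Hom.f $hs)
    have h₁ : s.f ≫ biprod.fst = P.obj.e ≫ s.f ≫ biprod.snd := by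
      simpa using s.comm =≫ biprod.snd
    -- The second component of the section `s` is a contracting homotopy of `P`; it is transported
    -- along `α` and `β`.
    refine ⟨α.hom.f ≫ s.f ≫ biprod.snd ≫ β.hom.f, ?_⟩
    have h₂ : 𝟙 P.obj.N = P.obj.e ≫ s.f ≫ biprod.snd + s.f ≫ biprod.snd ≫ P.obj.e := by
      rw [← h₁, ← hs, biprod.desc_eq]
      simp
    rw [h]
    have h₃ := congr(α.hom.f ≫ $h₂ ≫ β.hom.f)
    have h₄ := α.hom.comm
    have h₅ := β.hom.comm
    simp only [Preadditive.comp_add, Preadditive.add_comp, Category.assoc, Category.id_comp,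
      reassoc_of% h₄, ← h₅] at h₃
    simpa using h₃
  · rintro ⟨h, hh⟩
    have : Projective X.obj.N := X.property
    have : Projective Y.obj.N := Y.property
    refine ⟨⟨free Y.obj.N, inferInstanceAs (Projective (Y.obj.N ⊞ Y.obj.N))⟩,
      inferInstanceAs (Projective (free Y.obj.N)), ⟨freeLift h⟩, ⟨freeDesc (𝟙 _)⟩, ?_⟩
    rw [hh]
    simp

end PerfDiff

/-! ### Maps and homotopies out of complexes in degrees 0 and 1 -/

namespace CochainComplex

open HomComplex

variable {C : Type u} [Category.{v} C] [Preadditive C]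
  {K L M : CochainComplex C ℤ}

lemma hom_ext_of_isStrictly [K.IsStrictlyGE 0] [K.IsStrictlyLE 1] {f g : K ⟶ M}
    (h₀ : f.f 0 = g.f 0) (h₁ : f.f 1 = g.f 1) : f = g := by
  ext i
  by_cases hi₀ : i < 0
  · exact (K.isZero_of_isStrictlyGE 0 i hi₀).eq_of_src _ _
  · by_cases hi₁ : 1 < i
    · exact (K.isZero_of_isStrictlyLE 1 i hi₁).eq_of_src _ _
    · obtain rfl | rfl : i = 0 ∨ i = 1 := by lia
      · exact h₀
      · exact h₁

/-- Since `M` need not stop in degree 1, the condition `h'` replaces commutation with `K.d 1 2 = 0`.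
-/
lemma exists_hom_of_isStrictly [K.IsStrictlyGE 0] [K.IsStrictlyLE 1]
    (f₀ : K.X 0 ⟶ M.X 0) (f₁ : K.X 1 ⟶ M.X 1) (h : f₀ ≫ M.d 0 1 = K.d 0 1 ≫ f₁)
    (h' : f₁ ≫ M.d 1 2 = 0) : ∃ f : K ⟶ M, f.f 0 = f₀ ∧ f.f 1 = f₁ := by
  let z : Cochain K M 0 := Cochain.single f₀ 0 + Cochain.single f₁ 0
  have hz₀ : z.v 0 0 (add_zero 0) = f₀ := by
    simp [z, Cochain.single_v_eq_zero]
  have hz₁ : z.v 1 1 (add_zero 1) = f₁ := by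
    simp [z, Cochain.single_v_eq_zero]
  have hz : δ 0 1 z = 0 := by
    ext p q hpq
    rw [δ_v 0 1 (zero_add 1) z p q hpq p q (by lia) hpq]
    by_cases hi₀ : p < 0
    · exact (K.isZero_of_isStrictlyGE 0 p hi₀).eq_of_src _ _
    · by_cases hi₁ : 1 < p
      · exact (K.isZero_of_isStrictlyLE 1 p hi₁).eq_of_src _ _
      · obtain rfl | rfl : p = 0 ∨ p = 1 := by lia
        · obtain rfl : 1 = q := by lia
          simp [hz₀, hz₁, h]
        · obtain rfl : 2 = q := by lia
          simp [hz₁, h', (K.isZero_of_isStrictlyLE 1 2 (by lia)).eq_of_tgt (K.d 1 2) 0]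
  exact ⟨Cocycle.homOf (Cocycle.mk z 1 (zero_add 1) hz), hz₀, hz₁⟩

/-- Only two components of a homotopy can be nonzero. The target is unrestricted so that both `L`
and `L⟦1⟧` qualify, the latter having a term in degree -1. -/
lemma nonempty_homotopy_iff_of_isStrictly [K.IsStrictlyGE 0] [K.IsStrictlyLE 1] (f g : K ⟶ M) :
    Nonempty (Homotopy f g) ↔ ∃ (p : K.X 0 ⟶ M.X (-1)) (s : K.X 1 ⟶ M.X 0),
      f.f 0 - g.f 0 = p ≫ M.d (-1) 0 + K.d 0 1 ≫ s ∧ f.f 1 - g.f 1 = s ≫ M.d 0 1 := by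
  have hd : K.d 1 2 = 0 := (K.isZero_of_isStrictlyLE 1 2 (by lia)).eq_of_tgt _ _
  constructor
  · rintro ⟨h⟩
    refine ⟨h.hom 0 (-1), h.hom 1 0, ?_, ?_⟩
    · have := h.comm 0
      rw [dNext_eq _ (show (ComplexShape.up ℤ).Rel 0 1 by simp),
        prevD_eq _ (show (ComplexShape.up ℤ).Rel (-1) 0 by simp)] at this
      rw [this]
      abel
    · have := h.comm 1
      rw [dNext_eq _ (show (ComplexShape.up ℤ).Rel 1 2 by simp),
        prevD_eq _ (show (ComplexShape.up ℤ).Rel 0 1 by simp)] at this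
      simp [this, hd]
  · rintro ⟨p, s, h₀, h₁⟩
    let z : Cochain K M (-1) := Cochain.single p (-1) + Cochain.single s (-1)
    have hz₀ : z.v 0 (-1) (by lia) = p := by
      simp [z, Cochain.single_v_eq_zero]
    have hz₁ : z.v 1 0 (by lia) = s := by
      simp [z, Cochain.single_v_eq_zero]
    refine ⟨(Cochain.equivHomotopy f g).symm ⟨z, ?_⟩⟩
    rw [← sub_eq_iff_eq_add]
    ext i
    rw [δ_v (-1) 0 (by lia) z i i (by lia) (i - 1) (i + 1) rfl rfl]
    by_cases hi₀ : i < 0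
    · exact (K.isZero_of_isStrictlyGE 0 i hi₀).eq_of_src _ _
    · by_cases hi₁ : 1 < i
      · exact (K.isZero_of_isStrictlyLE 1 i hi₁).eq_of_src _ _
      · obtain rfl | rfl : i = 0 ∨ i = 1 := by lia
        · simp [hz₀, hz₁, h₀]
        · simp [hz₁, h₁, hd]

end CochainComplex

namespace CochainComplex

variable {C : Type u} [Category.{v} C] [Preadditive C]

/-- The terms of a shifted cochain complex. -/
def shiftXIso (K : CochainComplex C ℤ) {n i m : ℤ} (h : i + n = m) : (K⟦n⟧).X i ≅ K.X m :=
  HomologicalComplex.XIsoOfEq K h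

@[simp]
lemma shift_map_f_comp_shiftXIso_hom {K L : CochainComplex C ℤ} (f : K ⟶ L) {n i m : ℤ}
    (h : i + n = m) : (f⟦n⟧').f i ≫ (L.shiftXIso h).hom = (K.shiftXIso h).hom ≫ f.f m := by
  subst h
  simp [shiftXIso, HomologicalComplex.XIsoOfEq]

lemma shiftXIso_one_hom_comp_d (K : CochainComplex C ℤ) {i j m p : ℤ} (h : i + 1 = m)
    (h' : j + 1 = p) :
    (K.shiftXIso h).hom ≫ K.d m p = - (K⟦(1 : ℤ)⟧).d i j ≫ (K.shiftXIso h').hom := by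
  subst h h'
  simp only [shiftXIso, HomologicalComplex.XIsoOfEq, eqToIso_refl, Iso.refl_hom,
    shiftFunctor_obj_d', Int.negOnePow_one, Units.neg_smul, one_smul]
  exact ((Category.id_comp _).trans (neg_neg _).symm).trans (congrArg _ (Category.comp_id _).symm)

lemma mono_shift_d (K : CochainComplex C ℤ) {n i j m p : ℤ} (h : i + n = m)
    (h' : j + n = p) [Mono (K.d m p)] : Mono ((K⟦n⟧).d i j) := by
  subst h h'
  rw [shiftFunctor_obj_d']
  obtain h | h := Int.units_eq_one_or n.negOnePow
  · simpa [h]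
  · simp only [h, Units.neg_smul, one_smul]
    have : Mono (-K.d (i + n) (j + n)) := ⟨fun g h w => by
      rw [← cancel_mono (K.d (i + n) (j + n))]
      simpa only [Preadditive.comp_neg, neg_inj] using w⟩
    exact this

end CochainComplex

/-- Two-term complexes `K⁰ ⟶ K¹` of projective objects with a monic differential. -/
structure TwoTermComplex (C : Type u) [Category.{v} C] [Preadditive C] where
  /-- the underlying cochain complex -/
  K : CochainComplex C ℤ
  isStrictlyGE : K.IsStrictlyGE 0
  isStrictlyLE : K.IsStrictlyLE 1
  projective₀ : Projective (K.X 0)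
  projective₁ : Projective (K.X 1)
  mono_d : Mono (K.d 0 1)

/-! ### Two-term complexes and their total differential structures -/

namespace TwoTermComplex

open CochainComplex

attribute [instance] isStrictlyGE isStrictlyLE projective₀ projective₁ mono_d

section

variable {C : Type u} [Category.{v} C] [Preadditive C]

/-- The supports of `K` and `L⟦i⟧` are disjoint unless `i` is -1, 0 or 1. For `i = -1` they meet
only in degree 1, where the differential of `L⟦-1⟧` is monic and kills the map. -/
lemma shiftedHom_eq_zero {K L : TwoTermComplex C} {i : ℤ} (f : K.K ⟶ L.K⟦i⟧)
    (h₀ : i ≠ 0) (h₁ : i ≠ 1) : f = 0 := by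
  have hz (j : ℤ) (hj : j + i < 0 ∨ 1 < j + i) : IsZero ((L.K⟦i⟧).X j) := by
    refine IsZero.of_iso ?_ (L.K.shiftXIso rfl)
    obtain hj | hj := hj
    · exact L.K.isZero_of_isStrictlyGE 0 _ hj
    · exact L.K.isZero_of_isStrictlyLE 1 _ hj
  refine hom_ext_of_isStrictly ((hz 0 (by lia)).eq_of_tgt _ _) ?_
  by_cases h : i = -1
  · subst h
    have : Mono ((L.K⟦(-1 : ℤ)⟧).d 1 2) := mono_shift_d L.K (m := 0) (p := 1) (by lia) (by lia)
    rw [← cancel_mono ((L.K⟦(-1 : ℤ)⟧).d 1 2), f.comm,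
      (K.K.isZero_of_isStrictlyLE 1 2 (by lia)).eq_of_src (f.f 2) 0, comp_zero]
    exact zero_comp.symm
  · exact (hz 1 (by lia)).eq_of_tgt _ _

/-- Morphisms of two-term complexes in the orbit category of cochain complexes: only the
homogeneous components of degrees `0` and `1` may be nonzero. -/
@[ext]
structure Hom (K L : TwoTermComplex C) where
  /-- the component of degree `0` -/
  φ : K.K ⟶ L.K
  /-- the component of degree `1` -/
  β : K.K ⟶ L.K⟦(1 : ℤ)⟧

noncomputable instance : Category (TwoTermComplex C) where
  Hom := Hom
  id K := ⟨𝟙 _, 0⟩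
  comp f g := ⟨f.φ ≫ g.φ, f.φ ≫ g.β + f.β ≫ g.φ⟦1⟧'⟩
  id_comp f := by apply Hom.ext <;> simp
  comp_id f := by apply Hom.ext <;> simp
  assoc f g h := by apply Hom.ext <;> simp [add_assoc]

@[simp] lemma id_φ (K : TwoTermComplex C) : Hom.φ (𝟙 K) = 𝟙 K.K := rfl

@[simp] lemma id_β (K : TwoTermComplex C) : Hom.β (𝟙 K) = 0 := rfl

@[simp] lemma comp_φ {K L M : TwoTermComplex C} (f : K ⟶ L) (g : L ⟶ M) :
    (f ≫ g).φ = f.φ ≫ g.φ := rfl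

@[simp] lemma comp_β {K L M : TwoTermComplex C} (f : K ⟶ L) (g : L ⟶ M) :
    (f ≫ g).β = f.φ ≫ g.β + f.β ≫ g.φ⟦1⟧' := rfl

open OrbitCategory

variable (C) in
/-- The functor from two-term complexes to the orbit category of cochain complexes. -/
@[simps]
noncomputable def toOrbit : TwoTermComplex C ⥤ OrbitCategory (CochainComplex C ℤ) where
  obj K := ⟨K.K⟩
  map f := homMk 0 (ShiftedHom.mk₀ 0 rfl f.φ) + homMk 1 f.β
  map_id K := by
    simp only [id_φ, id_β, map_zero, add_zero]
    rfl
  map_comp {K L M} f g := by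
    -- The product of the degree 1 parts has degree 2, so the composition law may omit it.
    have h : ShiftedHom.comp f.β g.β (show (1 : ℤ) + 1 = 2 by lia) = 0 :=
      shiftedHom_eq_zero _ (by lia) (by lia)
    rw [Preadditive.comp_add, Preadditive.add_comp, Preadditive.add_comp,
      homMk_comp 0 (zero_add 0), homMk_comp 1 (add_zero 1), homMk_comp 1 (zero_add 1),
      homMk_comp 2 (by lia), h, ShiftedHom.mk₀_comp_mk₀, ShiftedHom.mk₀_comp,
      ShiftedHom.comp_mk₀]
    rw [comp_φ, comp_β, map_add, map_zero]
    abel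

/-- The part of degree `1` of a morphism, as a morphism `K⁰ ⟶ L¹`. -/
def Hom.b {K L : TwoTermComplex C} (f : K.Hom L) : K.K.X 0 ⟶ L.K.X 1 :=
  f.β.f 0 ≫ (L.K.shiftXIso (zero_add 1)).hom

lemma b_id (K : TwoTermComplex C) : Hom.b (𝟙 K) = 0 := by
  rw [Hom.b, id_β, HomologicalComplex.zero_f, zero_comp]

lemma b_comp {K L M : TwoTermComplex C} (f : K ⟶ L) (g : L ⟶ M) :
    (f ≫ g).b = f.φ.f 0 ≫ g.b + f.b ≫ g.φ.f 1 := by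
  rw [Hom.b, comp_β, HomologicalComplex.add_f_apply, Preadditive.add_comp,
    HomologicalComplex.comp_f, HomologicalComplex.comp_f, Category.assoc, Category.assoc,
    shift_map_f_comp_shiftXIso_hom, Hom.b, Hom.b, Category.assoc]

variable [HasBinaryBiproducts C]

/-- The perfect differential structure `K⁰ ⊞ K¹` attached to a two-term complex. -/
noncomputable abbrev totObj (K : TwoTermComplex C) : PerfDiff C where
  obj :=
    { N := K.K.X 0 ⊞ K.K.X 1
      e := biprod.fst ≫ K.K.d 0 1 ≫ biprod.inr
      e_comp_e := by simp }
  property := (inferInstance : Projective (K.K.X 0 ⊞ K.K.X 1))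

variable (C) in
/-- The functor sending a two-term complex `K` to the differential structure `K⁰ ⊞ K¹`. -/
noncomputable abbrev tot : TwoTermComplex C ⥤ PerfDiff C where
  obj K := K.totObj
  map {K L} f := ObjectProperty.homMk
    { f := biprod.desc (biprod.lift (f.φ.f 0) f.b) (f.φ.f 1 ≫ biprod.inr)
      comm := by
        refine biprod.hom_ext' _ _ ?_ ?_ <;> refine biprod.hom_ext _ _ ?_ ?_ <;> simp }
  map_id K := by
    ext <;> simp [b_id]
  map_comp {K L M} f g := by
    ext <;> simp [b_comp]


/-- In matrix form, the entry `K¹ ⟶ L⁰` of a homotopy of differential structures is a homotopy for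
`φ`, and its diagonal entries form one for `β`. -/
lemma homotopic_tot_map_iff {K L : TwoTermComplex C} (f g : K ⟶ L) :
    PerfDiff.homotopic C ((tot C).map f) ((tot C).map g) ↔
      Nonempty (Homotopy f.φ g.φ) ∧ Nonempty (Homotopy f.β g.β) := by
  have hd₀ : (L.K⟦(1 : ℤ)⟧).d (-1) 0 =
      -(L.K.shiftXIso (neg_add_cancel 1)).hom ≫ L.K.d 0 1 ≫ (L.K.shiftXIso (zero_add 1)).inv := by
    rw [← Category.assoc, L.K.shiftXIso_one_hom_comp_d (neg_add_cancel 1) (zero_add 1),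
      Preadditive.neg_comp, neg_neg, Category.assoc, Iso.hom_inv_id, Category.comp_id]
  have hd₁ (s : K.K.X 1 ⟶ (L.K⟦(1 : ℤ)⟧).X 0) : f.β.f 1 - g.β.f 1 = s ≫ (L.K⟦(1 : ℤ)⟧).d 0 1 :=
    (IsZero.of_iso (L.K.isZero_of_isStrictlyLE 1 2 (by lia))
      (L.K.shiftXIso (show (1 : ℤ) + 1 = 2 by lia))).eq_of_tgt _ _
  have hb : f.b - g.b = (f.β.f 0 - g.β.f 0) ≫ (L.K.shiftXIso (zero_add 1)).hom :=
    (Preadditive.sub_comp _ _ _).symm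
  rw [nonempty_homotopy_iff_of_isStrictly, nonempty_homotopy_iff_of_isStrictly]
  constructor
  · rintro ⟨h, hh⟩
    have h₀₀ := congr(biprod.inl ≫ $hh ≫ biprod.fst)
    have h₀₁ := congr(biprod.inl ≫ $hh ≫ biprod.snd)
    have h₁₁ := congr(biprod.inr ≫ $hh ≫ biprod.snd)
    simp at h₀₀ h₀₁ h₁₁
    -- The zero is forced by `L⁻¹ = 0`; the minus sign below compensates that of the differential of
    -- `L⟦1⟧`.
    refine ⟨⟨0, biprod.inr ≫ h ≫ biprod.fst, ?_, ?_⟩,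
      ⟨-(biprod.inl ≫ h ≫ biprod.fst) ≫ (L.K.shiftXIso (neg_add_cancel 1)).inv,
        (biprod.inr ≫ h ≫ biprod.snd) ≫ (L.K.shiftXIso (zero_add 1)).inv, ?_, hd₁ _⟩⟩
    · simpa using h₀₀
    · simpa using h₁₁
    · rw [← cancel_mono (L.K.shiftXIso (zero_add 1)).hom, ← hb, h₀₁, hd₀]
      simp [-shiftFunctor_obj_X', add_comm]
  · rintro ⟨⟨p, r, h₀, h₁⟩, q, s, h₂, -⟩
    -- The entry `K⁰ ⟶ L¹` does not contribute to the homotopy relation and is taken to be zero.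
    refine ⟨biprod.desc
      (biprod.lift (-q ≫ (L.K.shiftXIso (neg_add_cancel 1)).hom) 0)
      (biprod.lift r (s ≫ (L.K.shiftXIso (zero_add 1)).hom)), ?_⟩
    rw [hd₀] at h₂
    rw [h₂] at hb
    have hp : p = 0 := (L.K.isZero_of_isStrictlyGE 0 (-1) (by lia)).eq_of_tgt _ _
    simp [hp] at h₀ 
    ext
    · simpa using h₀
    · simp [-shiftFunctor_obj_X', hb, add_comm]
    · simp
    · simpa using h₁

instance : (tot C).Full where
  map_surjective {K L} f := by
    have h := f.hom.comm
    have h₀₁ := congr(biprod.inl ≫ $h ≫ biprod.snd)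
    have h₁₁ := congr(biprod.inr ≫ $h ≫ biprod.snd)
    simp at h₀₁ h₁₁
    -- Monicity of the differential of `L` makes the matrix of `f` triangular.
    have h₁₀ : biprod.inr ≫ f.hom.f ≫ biprod.fst = 0 := by
      rw [← cancel_mono (L.K.d 0 1)]
      simpa using h₁₁
    obtain ⟨φ, hφ₀, hφ₁⟩ := exists_hom_of_isStrictly (M := L.K)
      (biprod.inl ≫ f.hom.f ≫ biprod.fst) (biprod.inr ≫ f.hom.f ≫ biprod.snd)
      (by simpa using h₀₁) ((L.K.isZero_of_isStrictlyLE 1 2 (by lia)).eq_of_tgt _ _)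
    obtain ⟨β, hβ₀, -⟩ := exists_hom_of_isStrictly (K := K.K) (M := L.K⟦(1 : ℤ)⟧)
      ((biprod.inl ≫ f.hom.f ≫ biprod.snd) ≫ (L.K.shiftXIso (zero_add 1)).inv) 0
      ((IsZero.of_iso (L.K.isZero_of_isStrictlyLE 1 2 (by lia))
        (L.K.shiftXIso (show (1 : ℤ) + 1 = 2 by lia))).eq_of_tgt _ _) zero_comp
    refine ⟨⟨φ, β⟩, ?_⟩
    ext
    · simpa using hφ₀
    · simp [-shiftFunctor_obj_X', Hom.b, hβ₀]
    · simpa using h₁₀.symm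
    · simpa using hφ₁

end

end TwoTermComplex

/-- Dimension shifting: the cokernel has projective dimension at most one, so the kernel of `P ⟶
coker f` is projective. -/
lemma IsHereditaryCategory.projective_of_mono {C : Type u} [Category.{v} C] [Abelian C]
    [IsHereditaryCategory C] {X P : C} (f : X ⟶ P) [Mono f] [Projective P] : Projective X := by
  have : HasProjectiveDimensionLE (cokernel f) 1 :=
    IsHereditaryCategory.hasProjectiveDimensionLE_one _
  have hS : (ShortComplex.mk f (cokernel.π f) (cokernel.condition f)).ShortExact :=
    { exact := ShortComplex.exact_cokernel f }
  rw [projective_iff_hasProjectiveDimensionLT_one]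
  exact hS.hasProjectiveDimensionLT_X₁ 1 inferInstance this

namespace TwoTermComplex

open OrbitCategory CochainComplex

section

variable {C : Type u} [Category.{v} C] [Abelian C]

/-- Any monomorphism between projective objects is the differential of a two-term complex. -/
lemma exists_arrowIso {P Q : C} (f : P ⟶ Q) [Projective P] [Projective Q] [Mono f] :
    ∃ (K : TwoTermComplex C) (e₀ : K.K.X 0 ≅ P) (e₁ : K.K.X 1 ≅ Q),
      K.K.d 0 1 ≫ e₁.hom = e₀.hom ≫ f := by
  have h : (ComplexShape.up ℤ).Rel 0 1 := by simp
  have hd := HomologicalComplex.double_d f h (by simp)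
  let K : TwoTermComplex C :=
    { K := HomologicalComplex.double f h
      isStrictlyGE := by
        rw [isStrictlyGE_iff]
        intro i hi
        exact HomologicalComplex.isZero_double_X _ _ _ (by lia) (by lia)
      isStrictlyLE := by
        rw [isStrictlyLE_iff]
        intro i hi
        exact HomologicalComplex.isZero_double_X _ _ _ (by lia) (by lia)
      projective₀ := Projective.of_iso (HomologicalComplex.doubleXIso₀ f h).symm ‹_›
      projective₁ := Projective.of_iso (HomologicalComplex.doubleXIso₁ f h (by simp)).symm ‹_›
      mono_d := by
        rw [hd]
        infer_instance }
  exact ⟨K, HomologicalComplex.doubleXIso₀ f h, HomologicalComplex.doubleXIso₁ f h (by simp),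
    by simp [K, hd]⟩

instance [IsHereditaryCategory C] : (tot C).EssSurj where
  mem_essImage := by
    rintro ⟨⟨N, e, he⟩, hN⟩
    have : Projective N := hN
    have : Projective (image e) := IsHereditaryCategory.projective_of_mono (image.ι e)
    have : Projective (kernel e) := IsHereditaryCategory.projective_of_mono (kernel.ι e)
    have hι : image.ι e ≫ e = 0 := by
      rw [← cancel_epi (factorThruImage e), image.fac_assoc, he, comp_zero]
    let ι : image e ⟶ kernel e := kernel.lift e (image.ι e) hι
    have hι' : ι ≫ kernel.ι e = image.ι e := kernel.lift_ι _ _ _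
    have : Mono ι := mono_of_mono_fac hι'
    -- Projectivity of the image splits `N` as `im e ⊞ ker e`, with `r` below the projection to the
    -- kernel; `e` then becomes the inclusion `ι`.
    obtain ⟨σ, hσ⟩ : ∃ σ, σ ≫ factorThruImage e = 𝟙 (image e) :=
      ⟨_, Projective.factorThru_comp (𝟙 _) (factorThruImage e)⟩
    have hσ' : σ ≫ e = image.ι e := by
      simpa using hσ =≫ image.ι e
    have hk : kernel.ι e ≫ factorThruImage e = 0 := by
      rw [← cancel_mono (image.ι e)]
      simp
    obtain ⟨K, e₀, e₁, h⟩ := exists_arrowIso ι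
    let r : N ⟶ kernel e := kernel.lift e (𝟙 N - factorThruImage e ≫ σ) (by simp [hσ'])
    have hr : r ≫ kernel.ι e = 𝟙 N - factorThruImage e ≫ σ := kernel.lift_ι _ _ _
    have hkr : kernel.ι e ≫ r = 𝟙 _ := by
      rw [← cancel_mono (kernel.ι e)]
      simp [hr, reassoc_of% hk]
    have hσr : σ ≫ r = 0 := by
      rw [← cancel_mono (kernel.ι e)]
      simp [hr, reassoc_of% hσ]
    let f : K.K.X 0 ⊞ K.K.X 1 ⟶ N := biprod.desc (e₀.hom ≫ σ) (e₁.hom ≫ kernel.ι e)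
    let g : N ⟶ K.K.X 0 ⊞ K.K.X 1 := biprod.lift (factorThruImage e ≫ e₀.inv) (r ≫ e₁.inv)
    have hfg : f ≫ g = 𝟙 _ := by
      ext <;> simp [f, g, reassoc_of% hσ, reassoc_of% hk, reassoc_of% hkr, reassoc_of% hσr]
    have hgf : g ≫ f = 𝟙 _ := by
      simp [f, g, hr]
    have hf : f ≫ e = (biprod.fst ≫ K.K.d 0 1 ≫ biprod.inr) ≫ f := by
      ext
      · simp [f, hσ', reassoc_of% h, hι']
      · simp [f]
    have hg : g ≫ (biprod.fst ≫ K.K.d 0 1 ≫ biprod.inr) = e ≫ g := by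
      calc _ = (g ≫ (biprod.fst ≫ K.K.d 0 1 ≫ biprod.inr)) ≫ f ≫ g := by simp [hfg]
        _ = (g ≫ f) ≫ e ≫ g := by simp only [Category.assoc, reassoc_of% hf]
        _ = e ≫ g := by simp [hgf]
    refine ⟨K, ⟨ObjectProperty.isoMk _
      { hom := ⟨f, hf⟩
        inv := ⟨g, hg⟩
        hom_inv_id := DiffStructure.hom_ext hfg
        inv_hom_id := DiffStructure.hom_ext hgf }⟩⟩

end

section

variable {C : Type u} [Category.{v} C] [Abelian C] [HasDerivedCategory.{w} C]

instance (K : TwoTermComplex C) : K.K.IsKProjective := by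
  have (n : ℤ) : Projective (K.K.X n) := by
    by_cases h₀ : n = 0
    · subst h₀; infer_instance
    by_cases h₁ : n = 1
    · subst h₁; infer_instance
    have hz : IsZero (K.K.X n) := by
      by_cases h : n < 0
      · exact K.K.isZero_of_isStrictlyGE 0 n h
      · exact K.K.isZero_of_isStrictlyLE 1 n (by lia)
    exact ⟨fun f p _ => ⟨0, hz.eq_of_src _ _⟩⟩
  exact isKProjective_of_projective K.K 1

end

end TwoTermComplex

/-! ### Passage to the derived category -/

namespace CochainComplex.IsKProjective

variable {C : Type u} [Category.{v} C] [Abelian C] [HasDerivedCategory.{w} C]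

open DerivedCategory

lemma Q_map_surjective (K L : CochainComplex C ℤ) [K.IsKProjective] :
    Function.Surjective (Q.map : (K ⟶ L) → _) := by
  intro f
  obtain ⟨g, hg⟩ := (Qh_map_bijective K ((HomotopyCategory.quotient _ _).obj L)).surjective
    ((quotientCompQhIso C).hom.app K ≫ f ≫ (quotientCompQhIso C).inv.app L)
  obtain ⟨g, rfl⟩ := (HomotopyCategory.quotient _ _).map_surjective g
  refine ⟨g, ?_⟩
  rw [← cancel_epi ((quotientCompQhIso C).hom.app K), ← quotientCompQhIso_hom_naturality, hg]
  simp

lemma Q_map_eq_iff {K L : CochainComplex C ℤ} [K.IsKProjective] (f g : K ⟶ L) :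
    Q.map f = Q.map g ↔ Nonempty (Homotopy f g) := by
  rw [← cancel_epi ((quotientCompQhIso C).hom.app K), ← quotientCompQhIso_hom_naturality,
    ← quotientCompQhIso_hom_naturality, cancel_mono,
    (Qh_map_bijective K ((HomotopyCategory.quotient _ _).obj L)).injective.eq_iff]
  exact ⟨fun h => ⟨HomotopyCategory.homotopyOfEq _ _ h⟩,
    fun ⟨h⟩ => HomotopyCategory.eq_of_homotopy _ _ h⟩

end CochainComplex.IsKProjective

lemma DirectSum.of_add_of_eq_iff {ι : Type*} [DecidableEq ι] {A : ι → Type*}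
    [∀ i, AddCommMonoid (A i)] {i j : ι} (hij : i ≠ j) (a a' : A i) (b b' : A j) :
    of A i a + of A j b = of A i a' + of A j b' ↔ a = a' ∧ b = b' := by
  refine ⟨fun h => ⟨?_, ?_⟩, by rintro ⟨rfl, rfl⟩; rfl⟩
  · simpa [of_eq_of_ne _ _ _ hij, add_apply] using congr($h i)
  · simpa [of_eq_of_ne _ _ _ hij.symm, add_apply] using congr($h j)

lemma OrbitCategory.homMk_zero_add_homMk_one_eq_iff {D : Type*} [Category* D] [Preadditive D]
    [HasShift D ℤ] [∀ n : ℤ, (shiftFunctor D n).Additive] {X Y : D}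
    (a a' : ShiftedHom X Y (0 : ℤ)) (b b' : ShiftedHom X Y (1 : ℤ)) :
    homMk 0 a + homMk 1 b = homMk 0 a' + homMk 1 b' ↔ a = a' ∧ b = b' :=
  DirectSum.of_add_of_eq_iff (A := fun i : ℤ => ShiftedHom X Y i) zero_ne_one a a' b b'

namespace TwoTermComplex

open OrbitCategory CochainComplex DerivedCategory

variable {C : Type u} [Category.{v} C] [Abelian C] [HasDerivedCategory.{w} C]

/-- The action on morphisms of `toDerivedOrbit`. -/
noncomputable def derivedHom {K L : TwoTermComplex C} (φ : K.K ⟶ L.K) (β : K.K ⟶ L.K⟦(1 : ℤ)⟧) :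
    (⟨Q.obj K.K⟩ : OrbitCategory (DerivedCategory C)) ⟶ ⟨Q.obj L.K⟩ :=
  homMk 0 (ShiftedHom.mk₀ 0 rfl (Q.map φ)) + homMk 1 (ShiftedHom.map β Q)

variable (C) in
/-- The functor from two-term complexes to the orbit category of the derived category. -/
noncomputable def toDerivedOrbit : TwoTermComplex C ⥤ OrbitCategory (DerivedCategory C) :=
  toOrbit C ⋙ mapOrbit DerivedCategory.Q

lemma toDerivedOrbit_map {K L : TwoTermComplex C} (f : K ⟶ L) :
    (toDerivedOrbit C).map f = derivedHom f.φ f.β := by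
  refine ((mapOrbit Q).map_add (f := homMk 0 (ShiftedHom.mk₀ 0 rfl f.φ))
    (g := homMk 1 f.β)).trans ?_
  rw [mapOrbit_map_homMk, mapOrbit_map_homMk, ShiftedHom.map_mk₀]
  rfl

lemma derivedHom_eq_iff {K L : TwoTermComplex C} (φ φ' : K.K ⟶ L.K)
    (β β' : K.K ⟶ L.K⟦(1 : ℤ)⟧) :
    derivedHom φ β = derivedHom φ' β' ↔
      Nonempty (Homotopy φ φ') ∧ Nonempty (Homotopy β β') := by
  rw [derivedHom, derivedHom, homMk_zero_add_homMk_one_eq_iff,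
    ← IsKProjective.Q_map_eq_iff, ← IsKProjective.Q_map_eq_iff]
  refine and_congr ?_ ?_
  · exact (ShiftedHom.homEquiv 0 rfl).injective.eq_iff
  · exact cancel_mono _

lemma toDerivedOrbit_map_eq_iff {K L : TwoTermComplex C} (f g : K ⟶ L) :
    (toDerivedOrbit C).map f = (toDerivedOrbit C).map g ↔
      Nonempty (Homotopy f.φ g.φ) ∧ Nonempty (Homotopy f.β g.β) := by
  rw [toDerivedOrbit_map, toDerivedOrbit_map]
  exact derivedHom_eq_iff _ _ _ _

/-- Each homogeneous component lifts to a chain map by K-projectivity, and that lift is zero outside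
degrees 0 and 1. -/
lemma derivedHom_surjective {K L : TwoTermComplex C}
    (f : (⟨Q.obj K.K⟩ : OrbitCategory (DerivedCategory C)) ⟶ ⟨Q.obj L.K⟩) :
    ∃ (φ : K.K ⟶ L.K) (β : K.K ⟶ L.K⟦(1 : ℤ)⟧), derivedHom φ β = f := by
  induction f using hom_induction with
  | zero => exact ⟨0, 0, by simp [derivedHom, ShiftedHom.map]⟩
  | add f g hf hg =>
    obtain ⟨φ, β, rfl⟩ := hf
    obtain ⟨φ', β', rfl⟩ := hg
    refine ⟨φ + φ', β + β', ?_⟩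
    simp only [derivedHom, Functor.map_add, ShiftedHom.mk₀_add, ShiftedHom.map_add, map_add]
    abel
  | homMk i f =>
    obtain ⟨g, hg⟩ := IsKProjective.Q_map_surjective K.K (L.K⟦i⟧)
      (f ≫ (Q.commShiftIso i).inv.app L.K)
    obtain rfl : ShiftedHom.map g Q = f := by
      rw [ShiftedHom.map, hg, Category.assoc, Iso.inv_hom_id_app]
      exact Category.comp_id f
    by_cases h₀ : i = 0
    · subst h₀
      obtain ⟨g, rfl⟩ := (ShiftedHom.homEquiv (0 : ℤ) rfl).surjective g
      refine ⟨g, 0, ?_⟩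
      rw [derivedHom, ShiftedHom.map_zero, map_zero, add_zero, ShiftedHom.homEquiv_apply,
        ShiftedHom.map_mk₀]
    · by_cases h₁ : i = 1
      · subst h₁
        exact ⟨0, g, by simp [derivedHom]⟩
      · refine ⟨0, 0, ?_⟩
        obtain rfl := shiftedHom_eq_zero g h₀ h₁
        simp [derivedHom, ShiftedHom.map]

instance : (toDerivedOrbit C).Full where
  map_surjective {K L} f := by
    obtain ⟨φ, β, h⟩ := derivedHom_surjective f
    exact ⟨⟨φ, β⟩, (toDerivedOrbit_map _).trans h⟩

end TwoTermComplex

/-- An additive functor identifying direct summands also identifies their direct sums. -/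
lemma CategoryTheory.Functor.nonempty_iso_obj_biprod {D E : Type*} [Category* D] [Category* E]
    [Preadditive D] [Preadditive E] [HasBinaryBiproducts D] (F : D ⥤ E) [F.Additive]
    {X X' Y Y' : D} (e : F.obj X ≅ F.obj X') (e' : F.obj Y ≅ F.obj Y') :
    Nonempty (F.obj (X ⊞ Y) ≅ F.obj (X' ⊞ Y')) := by
  have := preservesBinaryBiproducts_of_preservesBiproducts F
  have := F.hasBinaryBiproduct_of_preserves X Y
  have := F.hasBinaryBiproduct_of_preserves X' Y'
  exact ⟨F.mapBiprod X Y ≪≫ biprod.mapIso e e' ≪≫ (F.mapBiprod X' Y').symm⟩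

/-! ### Resolutions and splitting of bounded objects -/

namespace TwoTermComplex

open OrbitCategory CochainComplex DerivedCategory Pretriangulated

variable {C : Type u} [Category.{v} C] [Abelian C] [HasDerivedCategory.{w} C]

/-- Monicity of `d` kills the homology in degree 0. -/
instance (K : TwoTermComplex C) : K.K.IsGE 1 := by
  rw [CochainComplex.isGE_iff]
  intro i hi
  by_cases h : i = 0
  · subst h
    rw [HomologicalComplex.exactAt_iff' _ (-1) 0 1 (by simp) (by simp), ShortComplex.exact_iff_mono]
    · exact inferInstanceAs (Mono (K.K.d 0 1))
    · exact (K.K.isZero_of_isStrictlyGE 0 (-1) (by lia)).eq_of_src _ _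
  · exact K.K.exactAt_of_isGE 0 i (by lia)

/-- The homology in degree `1` of a two-term complex. -/
noncomputable def homologyOneIso (K : TwoTermComplex C) :
    K.K.homology 1 ≅ cokernel (K.K.d 0 1) :=
  K.K.isoHomologyι 1 2 (by simp)
      ((K.K.isZero_of_isStrictlyLE 1 2 (by lia)).eq_of_tgt _ _) ≪≫
    (K.K.opcyclesIsCokernel 0 1 (by simp)).coconePointUniqueUpToIso
      (colimit.isColimit (parallelPair (K.K.d 0 1) 0))

/-- A two-term complex is isomorphic to its homology in the derived category. -/
lemma nonempty_iso_singleFunctor_obj (K : TwoTermComplex C) :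
    Nonempty (Q.obj K.K ≅ (DerivedCategory.singleFunctor C 1).obj (cokernel (K.K.d 0 1))) := by
  obtain ⟨Y, ⟨e⟩⟩ := exists_iso_singleFunctor_obj_of_isGE_of_isLE (Q.obj K.K) 1
  -- `Y` is identified by taking homology in degree 1.
  have e' : cokernel (K.K.d 0 1) ≅ Y :=
    K.homologyOneIso.symm ≪≫ ((homologyFunctorFactors C 1).app K.K).symm ≪≫
      (homologyFunctor C 1).mapIso e ≪≫ (homologyFunctorFactors C 1).app _ ≪≫
      (HomologicalComplex.homologyFunctorSingleIso C (.up ℤ) 1).app Y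
  exact ⟨e ≪≫ (DerivedCategory.singleFunctor C 1).mapIso e'.symm⟩

lemma exists_iso_singleFunctor_obj [EnoughProjectives C] [IsHereditaryCategory C] (H : C) :
    ∃ K : TwoTermComplex C, Nonempty (Q.obj K.K ≅ (DerivedCategory.singleFunctor C 1).obj H) := by
  have : Projective (kernel (Projective.π H)) :=
    IsHereditaryCategory.projective_of_mono (kernel.ι _)
  obtain ⟨K, e₀, e₁, h⟩ := exists_arrowIso (kernel.ι (Projective.π H))
  obtain ⟨e⟩ := K.nonempty_iso_singleFunctor_obj
  exact ⟨K, ⟨e ≪≫ (DerivedCategory.singleFunctor C 1).mapIso (cokernel.mapIso _ _ e₀ e₁ h ≪≫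
    (Abelian.epiIsCokernelOfKernel _ (limit.isLimit _) |>.coconePointUniqueUpToIso
      (cokernelIsCokernel _)).symm)⟩⟩

lemma hom_eq_zero_of_isLE (K : TwoTermComplex C) {X : DerivedCategory C} [X.IsLE (-1)]
    (f : Q.obj K.K ⟶ X) : f = 0 := by
  obtain ⟨L, _, ⟨e⟩⟩ := X.exists_iso_Q_obj_of_isLE (-1)
  obtain ⟨g, hg⟩ := IsKProjective.Q_map_surjective K.K L (f ≫ e.hom)
  have : g = 0 := hom_ext_of_isStrictly ((L.isZero_of_isStrictlyLE (-1) 0 (by lia)).eq_of_tgt _ _)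
    ((L.isZero_of_isStrictlyLE (-1) 1 (by lia)).eq_of_tgt _ _)
  rw [← cancel_mono e.hom, ← hg, this]
  simp

end TwoTermComplex

namespace DerivedCategory

open OrbitCategory TwoTermComplex Pretriangulated

variable {C : Type u} [Category.{v} C] [Abelian C] [HasDerivedCategory.{w} C]

section

variable [EnoughProjectives C] [IsHereditaryCategory C]

/-- After shifting by `n - 1` the source has a projective resolution in degrees 0 and 1, while the
target lies in degrees at most -1. -/
lemma singleFunctor_obj_hom_eq_zero (H : C) (n m : ℤ) (h : m + 2 ≤ n) {X : DerivedCategory C}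
    [X.IsLE m] (f : (singleFunctor C n).obj H ⟶ X) : f = 0 := by
  obtain ⟨K, ⟨e⟩⟩ := exists_iso_singleFunctor_obj H
  let e' : ((singleFunctor C n).obj H)⟦n - 1⟧ ≅ (DerivedCategory.singleFunctor C 1).obj H :=
    ((singleFunctors C).shiftIso (n - 1) 1 n (by lia)).app H
  have : X.IsLE (n - 2) := TStructure.t.isLE_of_le X m (n - 2) (by lia)
  have : (X⟦n - 1⟧).IsLE (-1) := TStructure.t.isLE_shift X (n - 2) (n - 1) (-1) (by lia)
  apply (shiftFunctor (DerivedCategory C) (n - 1)).map_injective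
  rw [← cancel_epi (e.hom ≫ e'.inv), hom_eq_zero_of_isLE K (_ ≫ _), Functor.map_zero,
    comp_zero]

end

/-- In the orbit category, every bounded object is isomorphic to an object of `C`. -/
lemma exists_orbit_iso_singleFunctor_obj [EnoughProjectives C] [IsHereditaryCategory C]
    (X : DerivedCategory C) (a b : ℤ) [X.IsGE a] [X.IsLE b] :
    ∃ H : C, Nonempty ((⟨X⟩ : OrbitCategory (DerivedCategory C)) ≅
      ⟨(DerivedCategory.singleFunctor C 1).obj H⟩) := by
  have single (H : C) (n : ℤ) : Nonempty ((⟨(singleFunctor C n).obj H⟩ :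
      OrbitCategory (DerivedCategory C)) ≅ ⟨(DerivedCategory.singleFunctor C 1).obj H⟩) :=
    ⟨(shiftIso _ (n - 1)).symm ≪≫
      (proj _).mapIso (((singleFunctors C).shiftIso (n - 1) 1 n (by lia)).app H)⟩
  -- Induction on a bound for the amplitude: `a` stays fixed while truncation lowers `b`; at `k = 0`
  -- the object is zero.
  obtain ⟨k, hk⟩ : ∃ k : ℕ, b < a + k := ⟨(b - a).toNat + 1, by lia⟩
  induction k generalizing X b with
  | zero =>
    refine ⟨0, ⟨(proj _).mapIso (IsZero.iso (TStructure.t.isZero X b a (by lia)) ?_)⟩⟩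
    exact (singleFunctor C 1).map_isZero (isZero_zero C)
  | succ k ih =>
    by_cases hab : b < a + k
    · exact ih X b hab
    have : TStructure.t.IsGE X a := ‹_›
    have : TStructure.t.IsLE X b := ‹_›
    have : ((TStructure.t.truncLT b).obj X).IsLE (b - 1) := inferInstance
    obtain ⟨H, ⟨e⟩⟩ := ih ((TStructure.t.truncLT b).obj X) (b - 1) (by lia)
    obtain ⟨H', ⟨e'⟩⟩ :=
      exists_iso_singleFunctor_obj_of_isGE_of_isLE ((TStructure.t.truncGE b).obj X) b
    have hT := TStructure.t.triangleLTGE_distinguished b X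
    -- The connecting map goes from an object of `C` in degree `b` to degrees at most `b - 2`; it
    -- vanishes by heredity, so the truncation triangle splits.
    have hδ : ((TStructure.t.triangleLTGE b).obj X).mor₃ = 0 := by
      have : (((TStructure.t.triangleLTGE b).obj X).obj₁⟦(1 : ℤ)⟧).IsLE (b - 2) :=
        TStructure.t.isLE_shift ((TStructure.t.truncLT b).obj X) (b - 1) 1 (b - 2) (by lia)
      refine (cancel_epi e'.inv).1 (Eq.trans ?_ comp_zero.symm)
      exact singleFunctor_obj_hom_eq_zero H' b (b - 2) (by lia) (e'.inv ≫ _)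
    obtain ⟨f, -, -⟩ := exists_iso_binaryBiproduct_of_distTriang _ hT hδ
    obtain ⟨e''⟩ := single H' b
    obtain ⟨g⟩ := (proj (DerivedCategory C)).nonempty_iso_obj_biprod e
      ((proj (DerivedCategory C)).mapIso e' ≪≫ e'')
    have := preservesBinaryBiproducts_of_preservesBiproducts (singleFunctor C 1)
    exact ⟨H ⊞ H', ⟨(proj _).mapIso f ≪≫ g ≪≫
      (proj _).mapIso ((singleFunctor C 1).mapBiprod H H').symm⟩⟩

lemma essImage_mapOrbit_boundedι [EnoughProjectives C] [IsHereditaryCategory C] :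
    (mapOrbit (Bounded.ι (C := C))).essImage = (toDerivedOrbit C).essImage := by
  ext ⟨X⟩
  constructor
  · rintro ⟨⟨Y, ⟨a, _⟩, ⟨b, _⟩⟩, ⟨e⟩⟩
    obtain ⟨H, ⟨e'⟩⟩ := exists_orbit_iso_singleFunctor_obj Y a b
    obtain ⟨K, ⟨e''⟩⟩ := exists_iso_singleFunctor_obj H
    exact ⟨K, ⟨(proj _).mapIso e'' ≪≫ e'.symm ≪≫ e⟩⟩
  · rintro ⟨K, ⟨e⟩⟩
    exact ⟨⟨⟨Q.obj K.K, ⟨0, inferInstanceAs ((Q.obj K.K).IsGE 0)⟩,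
      ⟨1, inferInstanceAs ((Q.obj K.K).IsLE 1)⟩⟩⟩, ⟨e⟩⟩

end DerivedCategory

theorem theorem4p5 (C : Type u) [Category.{v} C] [Abelian C] [EnoughProjectives C]
    [IsHereditaryCategory C] [HasDerivedCategory.{w} C] :
    Nonempty (OrbitCategory (DerivedCategory.Bounded C) ≌ HomotopyPerfDiff C) ∧
    Nonempty (OrbitCategory (DerivedCategory.Bounded C) ≌ StablePerfDiff C) := by
  -- Allowing any congruence equal to homotopy settles both quotients at once.
  have h (r : HomRel (PerfDiff C)) [Congruence r] (hr : r = PerfDiff.homotopic C) :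
      Nonempty (OrbitCategory (DerivedCategory.Bounded C) ≌ CategoryTheory.Quotient r) := by
    subst hr
    refine nonempty_equivalence_of_essImage_eq (OrbitCategory.mapOrbit DerivedCategory.Bounded.ι)
      (TwoTermComplex.toDerivedOrbit C)
      (TwoTermComplex.tot C ⋙ Quotient.functor (PerfDiff.homotopic C))
      DerivedCategory.essImage_mapOrbit_boundedι (fun K L f g => ?_)
    rw [TwoTermComplex.toDerivedOrbit_map_eq_iff, Functor.comp_map, Functor.comp_map,
      Quotient.functor_map_eq_iff, TwoTermComplex.homotopic_tot_map_iff]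
  exact ⟨h _ rfl, h _ PerfDiff.stablyEqual_eq_homotopic⟩
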